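/- Let $M$ be a matroid with ground set $E$, possibly infinite (in the sense of Bruhn, Diestel, Kriesell, Pendavingh and Wollan), and suppose that $M$ is tame, i.e. $o\cap b$ is finite for every circuit $o$ and every cocircuit $b$ of $M$. Let $k$ be a finite field and $k^*=k\setminus\{0\}$. Then the following are equivalent. 1. $M$ is a thin sums matroid over $k$: there are a set $A$ and a family $(f_e\mid e\in E)$ of functions $A\to k$ such that a set $I\subseteq E$ is independent in $M$ if and only if the only thin dependence $(\lambda_e\mid e\in E)$ of $f$ with $\lambda_e=0$ for all $e\in E\setminus I$ is the zero family. Here a family $(\lambda_e\mid e\in E)$ of elements of $k$ is a thin dependence of $f$ if for each $a\in A$ only finitely many of the products $\lambda_e f_e(a)$ are nonzero and $\sum_{e\in E}\lambda_e f_e(a)=0$. 2. $M$ is $k$-paintable: there are functions $c_o:o\to k^*$, one for each circuit $o$ of $M$, and $d_b:b\to k^*$, one for each cocircuit $b$ of $M$, such that $\sum_{e\in o\cap b}c_o(e)\,d_b(e)=0$ for every circuit $o$ and every cocircuit $b$ of $M$. 3. Every minor $N$ of $M$ with finite ground set is $k$-representable: there is a map $\varphi$ from the ground set $E(N)$ to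 a $k$-vector space such that a set $I\subseteq E(N)$ is independent in $N$ if and only if the family $(\varphi(e)\mid e\in I)$ is linearly independent over $k$. -/

import Mathlib

namespace ThinSums

universe u v w

/-- A matroid is tame if every intersection of a circuit with a cocircuit is finite. -/
def IsTame {α : Type u} (M : Matroid α) : Prop :=
  ∀ o b : Set α, M.IsCircuit o → M.IsCocircuit b → (o ∩ b).Finite

/-- `∑_{e ∈ s} g e = 0`, including the assertion that the sum is well defined, i.e. that
only finitely many of its summands are nonzero. -/
def SumsToZero {α : Type u} {k : Type v} [AddCommMonoid k] (s : Set α) (g : α → k) : Prop :=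
  {e ∈ s | g e ≠ 0}.Finite ∧ ∑ᶠ e ∈ s, g e = 0

/-- The family `(l e | e ∈ E)` is a thin dependence of the family `(f e | e ∈ E)` of functions
`A → k`. Values of `f` and `l` outside `E` play no role. -/
def IsThinDependence {α : Type u} {k : Type v} {A : Type w} [Field k]
    (E : Set α) (f : α → A → k) (l : α → k) : Prop :=
  ∀ a : A, SumsToZero E (fun e => l e * f e a)

/-- `I` is thinly independent for `(f e | e ∈ E)`: the only thin dependence that vanishes
everywhere on `E` outside `I` is the zero family on `E`. -/
def IsThinlyIndependent {α : Type u} {k : Type v} {A : Type w} [Field k]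
    (E : Set α) (f : α → A → k) (I : Set α) : Prop :=
  ∀ l : α → k, IsThinDependence E f l → (∀ e ∈ E, e ∉ I → l e = 0) → ∀ e ∈ E, l e = 0

/-- `M` is a thin sums matroid over `k`: for some set `A` and some family of functions `A → k`
indexed by the ground set, the independent sets of `M` are exactly the thinly independent
subsets of the ground set. (Repeating an element of `A` changes nothing, so `A` can always be
taken to be a set of functions `α → k`, and the universe chosen for `A` is no restriction.) -/
def IsThinSumsMatroid {α : Type u} (M : Matroid α) (k : Type v) [Field k] : Prop :=
  ∃ (A : Type (max u v)) (f : α → A → k),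
    ∀ I : Set α, I ⊆ M.E → (M.Indep I ↔ IsThinlyIndependent M.E f I)

/-- `c` and `d` form a `k`-painting of `M`. Only the values `c o e` with `o` a circuit and `e ∈ o`,
and `d b e` with `b` a cocircuit and `e ∈ b`, are relevant. -/
def IsPainting {α : Type u} (M : Matroid α) {k : Type v} [Field k]
    (c d : Set α → α → kˣ) : Prop :=
  ∀ o b : Set α, M.IsCircuit o → M.IsCocircuit b →
    SumsToZero (o ∩ b) (fun e => (c o e : k) * (d b e : k))

/-- `M` is `k`-paintable if it has a `k`-painting. -/
def IsPaintable {α : Type u} (M : Matroid α) (k : Type v) [Field k] : Prop :=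
  ∃ c d : Set α → α → kˣ, IsPainting M c d

/-- `M` is `k`-representable: there is a map `φ` from its ground set to a `k`-vector space such that
a subset `I` of the ground set is independent iff the family `(φ e | e ∈ I)` is linearly
independent. (The span of the family is a quotient of `α →₀ k`, so the universe chosen for `V` is
no restriction.) -/
def IsRepresentable {α : Type u} (M : Matroid α) (k : Type v) [Field k] : Prop :=
  ∃ (V : Type (max u v)) (_ : AddCommGroup V) (_ : Module k V) (φ : α → V),
    ∀ I : Set α, I ⊆ M.E → (M.Indep I ↔ LinearIndepOn k φ I)

end ThinSums

/-! Paintings are the hub. The cocircuit functions of a painting, extended by zero, present `M` as a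
thin sums matroid. Conversely, in a thin sums matroid every circuit supports a thin dependence,
which gives `c`; for a cocircuit `b`, circuits meeting `b` in just two elements force `d b` up to
scale. For orthogonality to an arbitrary circuit `o`, eliminate its dependence on all of `b` but one
element, in finitely many steps by tameness. The last coefficient vanishes because supports of thin
dependences are unions of circuits (`exists_isCircuit_subset_support`, by linear duality) and no
circuit meets a cocircuit in one element.

Paintings pass to minors, and on a finite ground set thin sums are ordinary representations. For 3 →
2, finiteness of `k` makes the space of candidate paintings compact, so finitely many circuits and
cocircuits suffice, and `IsTame.exists_finite_minor` traces these in one finite minor. -/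

namespace ThinSums

open Set Matroid

/-! ### Calculus of finite-support sums -/

section SumsToZero

variable {α k : Type*}

lemma sumsToZero_iff_of_finset [AddCommMonoid k] {s : Set α} {g : α → k} {t : Finset α}
    (hts : (t : Set α) ⊆ s) (hg : ∀ e ∈ s, e ∉ t → g e = 0) :
    SumsToZero s g ↔ ∑ e ∈ t, g e = 0 := by
  have hsub : s ∩ Function.support g ⊆ t := fun e he ↦ by
    by_contra h
    exact he.2 (hg e he.1 h)
  have hfin : {e ∈ s | g e ≠ 0}.Finite := t.finite_toSet.subset hsub
  have hsum : ∑ᶠ e ∈ s, g e = ∑ e ∈ t, g e := by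
    rw [← finsum_mem_coe_finset]
    refine finsum_mem_inter_support_eq g s t (subset_antisymm ?_ ?_)
    · exact fun e he ↦ ⟨hsub he, he.2⟩
    · exact inter_subset_inter_left _ hts
  simp [SumsToZero, hfin, hsum]

lemma sumsToZero_congr [AddCommMonoid k] {s s' : Set α} {g g' : α → k} (hss : s ⊆ s')
    (h : ∀ e ∈ s, g e = g' e) (h' : ∀ e ∈ s', e ∉ s → g' e = 0) :
    SumsToZero s g ↔ SumsToZero s' g' := by
  have hset : {e ∈ s | g e ≠ 0} = {e ∈ s' | g' e ≠ 0} := by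
    ext e
    constructor
    · rintro ⟨hes, he⟩
      exact ⟨hss hes, h e hes ▸ he⟩
    · rintro ⟨hes, he⟩
      have hs : e ∈ s := by_contra fun hs ↦ he (h' e hes hs)
      exact ⟨hs, (h e hs).symm ▸ he⟩
  have hsum : ∑ᶠ e ∈ s, g e = ∑ᶠ e ∈ s', g' e := by
    rw [finsum_mem_congr rfl h]
    refine finsum_mem_inter_support_eq g' s s' (subset_antisymm ?_ ?_)
    · exact inter_subset_inter_left _ hss
    · exact fun e he ↦ ⟨by_contra fun hs ↦ he.2 (h' e he.1 hs), he.2⟩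
  rw [SumsToZero, SumsToZero, hset, hsum]

lemma SumsToZero.add [AddCommMonoid k] {s : Set α} {g g' : α → k} (h : SumsToZero s g)
    (h' : SumsToZero s g') : SumsToZero s (fun e ↦ g e + g' e) := by
  refine ⟨(h.1.union h'.1).subset ?_, ?_⟩
  · rintro e ⟨hes, he⟩
    by_contra hcon
    simp only [mem_union, mem_ofPred_eq, hes, true_and, not_or, not_not] at hcon
    simp [hcon] at he
  · rw [finsum_mem_add_distrib' h.1 h'.1, h.2, h'.2, add_zero]

lemma SumsToZero.const_mul [Semiring k] {s : Set α} {g : α → k} (h : SumsToZero s g) (c : k) :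
    SumsToZero s (fun e ↦ c * g e) := by
  refine ⟨h.1.subset fun e he ↦ ⟨he.1, fun h0 ↦ he.2 (by simp [h0])⟩, ?_⟩
  have hsum := (AddMonoidHom.mulLeft c).map_finsum_mem' h.1
  rw [h.2, map_zero] at hsum
  exact hsum.symm

end SumsToZero

/-! ### Thin dependences -/

section ThinDependence

variable {α k A : Type*} [Field k] {E : Set α} {f : α → A → k}

/-- The thin dependences of a family of functions form a subspace. -/
def thinDependences (E : Set α) (f : α → A → k) : Submodule k (α → k) where
  carrier := {l | IsThinDependence E f l}
  add_mem' h h' a := by simpa [add_mul] using (h a).add (h' a)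
  zero_mem' a := by simp [SumsToZero]
  smul_mem' c l h a := by simpa [mul_assoc] using (h a).const_mul c

lemma IsThinDependence.congr {l l' : α → k} (h : IsThinDependence E f l)
    (hl : ∀ e ∈ E, l e = l' e) : IsThinDependence E f l' := fun a ↦
  (sumsToZero_congr subset_rfl (fun e he ↦ by rw [hl e he]) (fun e he h ↦ (h he).elim)).1 (h a)

lemma isThinlyIndependent_iff_linearIndepOn (hE : E.Finite) {I : Set α} (hI : I ⊆ E) :
    IsThinlyIndependent E f I ↔ LinearIndepOn k f I := by
  classical
  lift I to Finset α using hE.subset hI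
  have hdep : ∀ l : α → k, (∀ e ∈ E, e ∉ I → l e = 0) →
      (IsThinDependence E f l ↔ ∑ i ∈ I, l i • f i = 0) := by
    intro l hl
    rw [funext_iff]
    refine forall_congr' fun a ↦ ?_
    rw [sumsToZero_iff_of_finset hI fun e he heI ↦ by rw [hl e he heI, zero_mul]]
    simp
  rw [linearIndepOn_finset_iff]
  constructor
  · intro h l hl e he
    have h0 : ∀ e ∈ E, e ∉ I → (fun e ↦ if e ∈ I then l e else 0) e = 0 :=
      fun e _ heI ↦ if_neg heI
    have := h _ ((hdep _ h0).2 ?_) h0 e (hI he)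
    · simpa [he] using this
    · rw [← hl]
      exact Finset.sum_congr rfl fun i hi ↦ by simp [hi]
  · intro h l hl h0 e he
    by_cases heI : e ∈ I
    · exact h l ((hdep l h0).1 hl) e heI
    · exact h0 e he heI

end ThinDependence

/-! ### Circuits and cocircuits in finite minors -/

section Circuits

variable {α : Type*} {M : Matroid α}

/-- Some cocircuit meets the independent set `C \ {y}` in `x` alone; it must contain `y`, or it
would meet `C` in a single element. -/
lemma exists_isCocircuit_inter_eq_pair {C : Set α} (hC : M.IsCircuit C) {x y : α} (hx : x ∈ C)
    (hy : y ∈ C) (hxy : x ≠ y) : ∃ K, M.IsCocircuit K ∧ C ∩ K = {x, y} := by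
  obtain ⟨K, hK, hKx⟩ := (hC.sdiff_singleton_indep hy).exists_isCocircuit_inter_eq_mem
    (show x ∈ C \ {y} from ⟨hx, hxy⟩)
  have hxK : x ∈ K := (hKx.symm.subset rfl).1
  refine ⟨K, hK, ?_⟩
  have hyK : y ∈ K := by
    by_contra hyK
    refine hC.inter_isCocircuit_ne_singleton hK (e := x) ?_
    rw [← hKx]
    ext e
    simp only [mem_inter_iff, mem_sdiff, mem_singleton_iff]
    grind
  ext e
  have := Set.ext_iff.1 hKx e
  simp only [mem_inter_iff, mem_sdiff, mem_singleton_iff, mem_insert_iff] at this ⊢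
  grind

lemma exists_isCircuit_inter_eq_pair {K : Set α} (hK : M.IsCocircuit K) {x y : α} (hx : x ∈ K)
    (hy : y ∈ K) (hxy : x ≠ y) : ∃ C, M.IsCircuit C ∧ C ∩ K = {x, y} := by
  obtain ⟨C, hC, h⟩ := exists_isCocircuit_inter_eq_pair hK.isCircuit hx hy hxy
  exact ⟨C, by simpa [isCocircuit_def] using hC, by rwa [inter_comm]⟩

/-- Contracting a set that avoids a suitable element and suitable finitely many cocircuits keeps
a prescribed finite part of a circuit inside a single circuit. -/
lemma exists_finite_isCocircuit_forall_contract {o X : Set α} (ho : M.IsCircuit o)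
    (hX : X.Finite) (hXo : X ⊆ o) :
    ∃ e ∈ o, ∃ 𝓚 : Set (Set α), 𝓚.Finite ∧ (∀ K ∈ 𝓚, M.IsCocircuit K) ∧
      ∀ C, e ∉ C → (∀ K ∈ 𝓚, Disjoint K C) → ∃ o', (M ／ C).IsCircuit o' ∧ X ⊆ o' ∧ o' ⊆ o := by
  obtain ⟨e, he⟩ := ho.nonempty
  have hK : ∀ x ∈ X \ {e}, ∃ K, M.IsCocircuit K ∧ o ∩ K = {x, e} := fun x hx ↦
    exists_isCocircuit_inter_eq_pair ho (hXo hx.1) he hx.2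
  choose! K hKc hKi using hK
  refine ⟨e, he, K '' (X \ {e}), (hX.sdiff).image K, ?_, ?_⟩
  · rintro _ ⟨x, hx, rfl⟩
    exact hKc x hx
  intro C heC hC
  have hecl : e ∈ (M ／ C).closure ((o \ {e}) \ C) := by
    rw [contract_closure_eq, sdiff_union_self]
    exact ⟨M.closure_mono subset_union_left (ho.mem_closure_sdiff_singleton_of_mem he), heC⟩
  obtain ⟨o', ho', hoc, heo'⟩ := exists_isCircuit_of_mem_closure hecl (by simp)
  have hsub : o' ⊆ o := ho'.trans (insert_subset he (sdiff_subset.trans sdiff_subset))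
  refine ⟨o', hoc, fun x hx ↦ ?_, hsub⟩
  obtain rfl | hne := eq_or_ne x e
  · exact heo'
  have hx' : x ∈ X \ {e} := ⟨hx, hne⟩
  have hcoc : (M ／ C).IsCocircuit (K x) :=
    contract_isCocircuit_iff.2 ⟨hKc x hx', hC _ (mem_image_of_mem K hx')⟩
  -- `K x` is still a cocircuit after contraction; if `o'` missed `x`, the two would meet in `e`
  -- alone.
  by_contra hxo'
  refine hoc.inter_isCocircuit_ne_singleton hcoc (e := e) (subset_antisymm ?_ ?_)
  · rintro y ⟨hyo, hyK⟩
    have : y ∈ ({x, e} : Set α) := hKi x hx' ▸ ⟨hsub hyo, hyK⟩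
    obtain rfl | h := this
    · exact (hxo' hyo).elim
    · exact h
  · rintro _ rfl
    exact ⟨heo', ((hKi x hx').symm.subset (by simp)).2⟩

/-- Finitely many circuits and finitely many cocircuits of a tame matroid can be traced, with
their intersections unchanged, in a single finite minor. -/
lemma IsTame.exists_finite_minor (hM : IsTame M) {𝓞 𝓑 : Set (Set α)} (h𝓞 : 𝓞.Finite)
    (h𝓑 : 𝓑.Finite) (hO : ∀ o ∈ 𝓞, M.IsCircuit o) (hB : ∀ b ∈ 𝓑, M.IsCocircuit b) :
    ∃ N, N ≤m M ∧ N.Finite ∧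
      (∀ o ∈ 𝓞, ∃ o', N.IsCircuit o' ∧ o' ⊆ o ∧ ∀ b ∈ 𝓑, o ∩ b ⊆ o') ∧
      (∀ b ∈ 𝓑, ∃ b', N.IsCocircuit b' ∧ b' ⊆ b ∧ ∀ o ∈ 𝓞, o ∩ b ⊆ b') := by
  cases isEmpty_or_nonempty α
  · exact ⟨M, .refl, ⟨toFinite _⟩, fun o ho ↦ ⟨o, hO o ho, subset_rfl, fun _ _ ↦ inter_subset_left⟩,
      fun b hb ↦ ⟨b, hB b hb, subset_rfl, fun _ _ ↦ inter_subset_right⟩⟩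
  have hfinO : ∀ o ∈ 𝓞, (⋃ b ∈ 𝓑, o ∩ b).Finite := fun o ho ↦
    h𝓑.biUnion fun b hb ↦ hM o b (hO o ho) (hB b hb)
  have hfinB : ∀ b ∈ 𝓑, (⋃ o ∈ 𝓞, o ∩ b).Finite := fun b hb ↦
    h𝓞.biUnion fun o ho ↦ hM o b (hO o ho) (hB b hb)
  have h1 := fun o (ho : o ∈ 𝓞) ↦ exists_finite_isCocircuit_forall_contract (hO o ho) (hfinO o ho)
    (iUnion₂_subset fun b _ ↦ inter_subset_left)
  have h2 := fun b (hb : b ∈ 𝓑) ↦ exists_finite_isCocircuit_forall_contract (hB b hb).isCircuit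
    (hfinB b hb) (iUnion₂_subset fun o _ ↦ inter_subset_right)
  choose! e heo 𝓚 h𝓚fin h𝓚 hcon using h1
  choose! e' heb 𝓛 h𝓛fin h𝓛 hdel using h2
  set 𝓞' : Set (Set α) := 𝓞 ∪ ⋃ b ∈ 𝓑, 𝓛 b with h𝓞'
  set 𝓑' : Set (Set α) := 𝓑 ∪ ⋃ o ∈ 𝓞, 𝓚 o with h𝓑'
  have h𝓞'fin : 𝓞'.Finite := h𝓞.union (h𝓑.biUnion h𝓛fin)
  have h𝓑'fin : 𝓑'.Finite := h𝓑.union (h𝓞.biUnion h𝓚fin)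
  have hO' : ∀ o ∈ 𝓞', M.IsCircuit o := by
    rintro o (ho | ho)
    · exact hO o ho
    · obtain ⟨b, hb, hob⟩ := mem_iUnion₂.1 ho
      simpa [isCocircuit_def] using h𝓛 b hb o hob
  have hB' : ∀ b ∈ 𝓑', M.IsCocircuit b := by
    rintro b (hb | hb)
    · exact hB b hb
    · obtain ⟨o, ho, hbo⟩ := mem_iUnion₂.1 hb
      exact h𝓚 o ho b hbo
  -- `F` is the ground set to keep, up to elements outside `M.E`. As it contains every intersection
  -- of a listed circuit and cocircuit, contracting the rest of the circuits avoids all listed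
  -- cocircuits, and deleting what remains avoids all listed circuits.
  set F : Set α := (⋃₀ 𝓞' ∩ ⋃₀ 𝓑') ∪ (e '' 𝓞 ∪ e' '' 𝓑) with hF
  have hFfin : F.Finite := by
    refine .union ?_ ((h𝓞.image e).union (h𝓑.image e'))
    refine (h𝓞'fin.biUnion fun o ho ↦ h𝓑'fin.biUnion fun b hb ↦
      hM o b (hO' o ho) (hB' b hb)).subset ?_
    rintro x ⟨⟨o, ho, hxo⟩, b, hb, hxb⟩
    exact mem_iUnion₂.2 ⟨o, ho, mem_iUnion₂.2 ⟨b, hb, hxo, hxb⟩⟩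
  set C : Set α := ⋃₀ 𝓞' \ F with hC
  set D : Set α := (M.E \ F) \ C with hD
  have hKC : ∀ b ∈ 𝓑', Disjoint b C := fun b hb ↦ disjoint_left.2 fun x hxb hxC ↦
    hxC.2 (Or.inl ⟨hxC.1, b, hb, hxb⟩)
  have hLD : ∀ o ∈ 𝓞', Disjoint o D := fun o ho ↦ disjoint_left.2 fun x hxo hxD ↦
    hxD.2 ⟨⟨o, ho, hxo⟩, hxD.1.2⟩
  refine ⟨M ／ C ＼ D, contract_delete_isMinor .., ⟨hFfin.subset ?_⟩, fun o ho ↦ ?_, fun b hb ↦ ?_⟩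
  · rintro x ⟨⟨hxE, hxC⟩, hxD⟩
    by_contra hxF
    exact hxD ⟨⟨hxE, hxF⟩, hxC⟩
  · obtain ⟨o', ho', hXo', hoo'⟩ := hcon o ho C
      (fun h ↦ h.2 (Or.inr (Or.inl (mem_image_of_mem e ho))))
      (fun K hK ↦ hKC K (Or.inr (mem_iUnion₂.2 ⟨o, ho, hK⟩)))
    exact ⟨o', delete_isCircuit_iff.2 ⟨ho', (hLD o (Or.inl ho)).mono_left hoo'⟩, hoo',
      fun b hb ↦ (subset_biUnion_of_mem (u := fun b ↦ o ∩ b) hb).trans hXo'⟩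
  · obtain ⟨b', hb', hXb', hbb'⟩ := hdel b hb D
      (fun h ↦ h.1.2 (Or.inr (Or.inr (mem_image_of_mem e' hb))))
      (fun L hL ↦ hLD L (Or.inr (mem_iUnion₂.2 ⟨b, hb, hL⟩)))
    refine ⟨b', ?_, hbb',
      fun o ho ↦ (subset_biUnion_of_mem (u := fun o ↦ o ∩ b) ho).trans hXb'⟩
    rw [isCocircuit_def, dual_contract_delete, ← contract_delete_comm _ disjoint_sdiff_left]
    exact delete_isCircuit_iff.2 ⟨hb', (hKC b (Or.inl hb)).mono_left hbb'⟩

end Circuits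

/-! ### Paintings give thin sums and pass to minors -/

section Painting

variable {α k : Type*} [Field k] {M : Matroid α}

/-- The extensions by zero of the cocircuit functions of a painting present the matroid as a thin
sums matroid. -/
lemma IsPaintable.isThinSumsMatroid (h : IsPaintable M k) : IsThinSumsMatroid M k := by
  classical
  obtain ⟨c, d, hcd⟩ := h
  refine ⟨ULift {b : Set α // M.IsCocircuit b},
    fun e b ↦ if e ∈ b.down.1 then (d b.down.1 e : k) else 0, fun I hI ↦ ⟨fun hind l hl h0 ↦ ?_,
      fun hind ↦ ?_⟩⟩
  · intro x hxE
    by_cases hxI : x ∈ I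
    swap
    · exact h0 x hxE hxI
    obtain ⟨b, hb, hbI⟩ := hind.exists_isCocircuit_inter_eq_mem hxI
    have hx : x ∈ b := (hbI.symm.subset rfl).1
    have hsum := hl ⟨⟨b, hb⟩⟩
    rw [sumsToZero_iff_of_finset (t := {x}) (by simpa using hxE)] at hsum
    · simpa [hx] using hsum
    · intro y hyE hyx
      by_cases hyI : y ∈ I
      · have hyb : y ∉ b := fun hyb ↦ hyx (by simpa using hbI.subset ⟨hyb, hyI⟩)
        simp [hyb]
      · simp [h0 y hyE hyI]
  · by_contra hdep
    obtain ⟨o, hoI, ho⟩ := (show M.Dep I from ⟨hdep, hI⟩).exists_isCircuit_subset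
    obtain ⟨x, hx⟩ := ho.nonempty
    have := hind (fun e ↦ if e ∈ o then (c o e : k) else 0) ?_
      (fun e _ heI ↦ if_neg fun heo ↦ heI (hoI heo)) x (ho.subset_ground hx)
    · simp [hx] at this
    rintro ⟨b, hb⟩
    refine (sumsToZero_congr (inter_subset_left.trans ho.subset_ground) ?_ ?_).1 (hcd o b ho hb)
    · rintro e ⟨heo, heb⟩
      simp [heo, heb]
    · intro e _ heob
      by_cases heo : e ∈ o
      · have heb : e ∉ b := fun heb ↦ heob ⟨heo, heb⟩
        simp [heb]
      · simp [heo]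

lemma IsPaintable.of_isMinor {N : Matroid α} (h : IsPaintable M k) (hN : N ≤m M) :
    IsPaintable N k := by
  obtain ⟨c, d, hcd⟩ := h
  obtain ⟨C, D, -, -, hCD, rfl⟩ := hN.exists_eq_contract_delete_disjoint
  have h1 : ∀ o, (M ／ C ＼ D).IsCircuit o → ∃ o', M.IsCircuit o' ∧ o ⊆ o' ∧ o' ⊆ o ∪ C :=
    fun o ho ↦ ho.of_delete.exists_subset_isCircuit_of_contract
  have h2 : ∀ b, (M ／ C ＼ D).IsCocircuit b → ∃ b', M.IsCocircuit b' ∧ b ⊆ b' ∧ b' ⊆ b ∪ D := by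
    intro b hb
    rw [isCocircuit_def, dual_contract_delete, ← contract_delete_comm _ hCD.symm] at hb
    exact hb.of_delete.exists_subset_isCircuit_of_contract
  choose! p hp hsp hps using h1
  choose! q hq hsq hqs using h2
  refine ⟨fun o ↦ c (p o), fun b ↦ d (q b), fun o b ho hb ↦ ?_⟩
  -- The lift of `o` adds only elements of `C` and that of `b` only elements of `D`; these are
  -- disjoint, so no new common element arises.
  have hinter : o ∩ b = p o ∩ q b := by
    refine subset_antisymm (inter_subset_inter (hsp o ho) (hsq b hb)) fun x hx ↦ ?_
    have hoE : x ∈ o → _ := fun h ↦ ho.subset_ground h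
    have hbE : x ∈ b → _ := fun h ↦ hb.subset_ground h
    have h3 := hps o ho hx.1
    have h4 := hqs b hb hx.2
    have h5 : x ∈ C → x ∉ D := fun h ↦ disjoint_left.1 hCD h
    simp only [delete_ground, contract_ground, mem_sdiff, mem_union, mem_inter_iff] at *
    tauto
  rw [hinter]
  exact hcd _ _ (hp o ho) (hq b hb)

end Painting

/-! ### Supports of thin dependences; thin sums give paintings -/

section Supports

variable {α k A : Type*} [Field k] {M : Matroid α} {f : α → A → k}

/-- Every circuit of a thin sums matroid is the support of a thin dependence. -/
lemma exists_isThinDependence_of_isCircuit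
    (hf : ∀ I ⊆ M.E, (M.Indep I ↔ IsThinlyIndependent M.E f I)) {o : Set α} (ho : M.IsCircuit o) :
    ∃ v : α → k, IsThinDependence M.E f v ∧ ∀ e, v e ≠ 0 ↔ e ∈ o := by
  classical
  have hdep := ho.not_indep
  rw [hf o ho.subset_ground, IsThinlyIndependent] at hdep
  push Not at hdep
  obtain ⟨v, hv, hvo, e, he, hve⟩ := hdep
  set S : Set α := {e ∈ M.E | v e ≠ 0} with hS
  have hSo : S ⊆ o := fun x hx ↦ by_contra fun hxo ↦ hx.2 (hvo x hx.1 hxo)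
  have hSdep : ¬ M.Indep S := by
    rw [hf S (sep_subset _ _)]
    exact fun h ↦ hve (h v hv (fun x hx hxS ↦ by_contra fun hvx ↦ hxS ⟨hx, hvx⟩) e he)
  have hSeq : S = o := ho.eq_of_not_indep_subset hSdep hSo
  refine ⟨fun e ↦ if e ∈ M.E then v e else 0, hv.congr fun e he ↦ by simp [he], fun e ↦ ?_⟩
  rw [← hSeq]
  simp [hS]

/-- The support of a thin dependence of a thin sums matroid is a union of circuits. -/
lemma exists_isCircuit_subset_support
    (hf : ∀ I ⊆ M.E, (M.Indep I ↔ IsThinlyIndependent M.E f I)) {v : α → k}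
    (hv : IsThinDependence M.E f v) {x : α} (hxE : x ∈ M.E) (hx : v x ≠ 0) :
    ∃ o, M.IsCircuit o ∧ x ∈ o ∧ ∀ e ∈ o, v e ≠ 0 := by
  classical
  set S : Set α := {e ∈ M.E | v e ≠ 0} with hS
  have hSE : S ⊆ M.E := sep_subset _ _
  by_contra! hcon
  have hxcl : x ∉ M.closure (S \ {x}) := by
    intro hxcl
    obtain ⟨o, hoS, ho, hxo⟩ := exists_isCircuit_of_mem_closure hxcl (by simp)
    obtain ⟨e, heo, he⟩ := hcon o ho hxo
    obtain rfl | h := hoS heo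
    · exact hx he
    · exact h.1.2 he
  obtain ⟨I, hI⟩ := M.exists_isBasis (S \ {x}) (sdiff_subset.trans hSE)
  have hB : M.Indep (insert x I) := by
    rw [hI.indep.insert_indep_iff_of_notMem fun h ↦ (hI.subset h).2 rfl]
    exact ⟨hxE, by rwa [hI.closure_eq_closure]⟩
  set B := insert x I with hBdef
  have hBS : B ⊆ S := insert_subset ⟨hxE, hx⟩ (hI.subset.trans sdiff_subset)
  have hBth := (hf B (hBS.trans hSE)).1 hB
  -- Since `v` vanishes nowhere on `S`, thinness makes each row finite on `S`, so rows live in `α →₀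
  -- k`, whose dual is all of `α → k`.
  have hrow : ∀ a, {e ∈ S | f e a ≠ 0}.Finite := fun a ↦ (hv a).1.subset
    fun e he ↦ ⟨he.1.1, mul_ne_zero he.1.2 he.2⟩
  set r : A → α →₀ k := fun a ↦ Finsupp.onFinset (hrow a).toFinset
    (fun e ↦ if e ∈ S then f e a else 0) (fun e he ↦ by simpa using he) with hr
  have hpair : ∀ l : α → k, (∀ e ∈ M.E, e ∉ S → l e = 0) → ∀ a,
      (SumsToZero M.E (fun e ↦ l e * f e a) ↔ Finsupp.linearCombination k l (r a) = 0) := by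
    intro l hl a
    rw [Finsupp.linearCombination_apply, Finsupp.onFinset_sum _ (by simp),
      sumsToZero_iff_of_finset (t := (hrow a).toFinset)]
    · rw [Finset.sum_congr rfl]
      intro e he
      have : e ∈ S := by simp at he; exact he.1
      simp [this, mul_comm]
    · intro e he
      simp at he
      exact hSE he.1
    · intro e heE he
      by_cases heS : e ∈ S
      · have : f e a = 0 := by simpa [heS] using he
        simp [this]
      · simp [hl e heE heS]
  have hker : ∀ l : α → k, (∀ e ∈ M.E, e ∉ S → l e = 0) → IsThinDependence M.E f l →
      ∀ y ∈ Submodule.span k (range r), Finsupp.linearCombination k l y = 0 := by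
    intro l hl hdep y hy
    have hle : Submodule.span k (range r) ≤ LinearMap.ker (Finsupp.linearCombination k l) := by
      rw [Submodule.span_le]
      rintro _ ⟨a, rfl⟩
      exact (hpair l hl a).1 (hdep a)
    exact hle hy
  -- Otherwise a separating functional would be a thin dependence supported in `B` and nonzero at
  -- `x`.
  have hmem : Finsupp.single x (1 : k) ∈
      Submodule.span k (range r) ⊔ Finsupp.supported k k Bᶜ := by
    by_contra hmem
    obtain ⟨φ, hφx, hφ⟩ := Submodule.exists_dual_map_eq_bot_of_notMem hmem inferInstance
    have hφ0 : ∀ y ∈ Submodule.span k (range r) ⊔ Finsupp.supported k k Bᶜ, φ y = 0 := fun y hy ↦ by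
      have := Submodule.mem_map_of_mem (f := φ) hy
      rwa [hφ, Submodule.mem_bot] at this
    have hlc : Finsupp.linearCombination k (fun e ↦ φ (Finsupp.single e 1)) = φ := by
      ext e
      simp
    have hlB : ∀ e ∉ B, φ (Finsupp.single e 1) = 0 := fun e he ↦
      hφ0 _ (Submodule.mem_sup_right (Finsupp.single_mem_supported k _ he))
    refine hφx (hBth (fun e ↦ φ (Finsupp.single e 1)) (fun a ↦ ?_) (fun e _ ↦ hlB e) x hxE)
    rw [hpair _ fun e _ heS ↦ hlB e fun heB ↦ heS (hBS heB), hlc]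
    exact hφ0 _ (Submodule.mem_sup_left (Submodule.subset_span (mem_range_self a)))
  obtain ⟨y, hy, z, hz, hyz⟩ := Submodule.mem_sup.1 hmem
  have hyB : ∀ e ∈ B, y e = Finsupp.single x (1 : k) e := by
    intro e he
    have hze : z e = 0 := by
      by_contra h
      exact (Finsupp.mem_supported _ _).1 hz (by simpa using h) he
    rw [← hyz, Finsupp.add_apply, hze, add_zero]
  have hyS : ∀ e ∈ S, y e = Finsupp.single x (1 : k) e := by
    intro e heS
    by_cases heB : e ∈ B
    · exact hyB e heB
    have hex : e ≠ x := fun h ↦ heB (h ▸ mem_insert x I)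
    have heI : e ∉ I := fun h ↦ heB (mem_insert_of_mem x h)
    have hecl : e ∈ M.closure I := by
      rw [hI.closure_eq_closure]
      exact M.mem_closure_of_mem' ⟨heS, hex⟩
    -- This fundamental circuit avoids `x`, and `y` vanishes on `I`, so pairing `y` with its
    -- dependence leaves only the term at `e`.
    obtain ⟨o, hoI, ho, heo⟩ := exists_isCircuit_of_mem_closure hecl heI
    obtain ⟨c, hc, hco⟩ := exists_isThinDependence_of_isCircuit hf ho
    have hoS : o ⊆ S := hoI.trans (insert_subset heS (hI.subset.trans sdiff_subset))
    have h0 := hker c (fun e' _ he' ↦ by_contra fun h ↦ he' (hoS ((hco e').1 h))) hc y hy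
    rw [Finsupp.linearCombination_apply, Finsupp.sum, Finset.sum_eq_single e] at h0
    · rw [Finsupp.single_eq_of_ne hex]
      simpa [(hco e).2 heo] using h0
    · intro e' _ hne
      by_cases he'o : e' ∈ o
      · have he'I : e' ∈ I := (hoI he'o).resolve_left hne
        have : e' ≠ x := fun h ↦ (hI.subset he'I).2 h
        rw [hyB e' (mem_insert_of_mem x he'I), Finsupp.single_eq_of_ne this, zero_smul]
      · rw [not_not.1 (mt (hco e').1 he'o), smul_zero]
    · intro h
      rw [Finsupp.notMem_support_iff.1 h, zero_smul]
  have h0 := hker v (fun e he heS ↦ by_contra fun h ↦ heS ⟨he, h⟩) hv y hy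
  have hsupp : ∀ e, e ∉ S → y e = 0 := by
    have hle : Submodule.span k (range r) ≤ Finsupp.supported k k S := by
      rw [Submodule.span_le]
      rintro _ ⟨a, rfl⟩
      refine (Finsupp.mem_supported _ _).2 fun e he ↦ by_contra fun heS ↦ ?_
      simp [hr, heS] at he
    exact fun e heS ↦ by_contra fun h ↦
      heS ((Finsupp.mem_supported _ _).1 (hle hy) (by simpa using h))
  have hyx : y = Finsupp.single x 1 := by
    ext e
    by_cases heS : e ∈ S
    · exact hyS e heS
    · have hex : e ≠ x := by
        rintro rfl
        exact heS ⟨hxE, hx⟩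
      rw [hsupp e heS, Finsupp.single_eq_of_ne hex]
  rw [hyx] at h0
  exact hx (by simpa using h0)

/-- In a tame thin sums matroid, the dependences on the circuits extend to a painting. -/
lemma IsThinSumsMatroid.isPaintable (hM : IsTame M) (h : IsThinSumsMatroid M k) :
    IsPaintable M k := by
  classical
  obtain ⟨A, f, hf⟩ := h
  have hv := fun o (ho : M.IsCircuit o) ↦ exists_isThinDependence_of_isCircuit hf ho
  choose! v hv hvo using hv
  have hd : ∀ b, M.IsCocircuit b → ∃ d : α → k, (∀ e ∈ b, d e ≠ 0) ∧
      ∀ o, M.IsCircuit o → SumsToZero (o ∩ b) (fun e ↦ v o e * d e) := by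
    intro b hb
    obtain ⟨e₀, he₀⟩ := hb.nonempty
    have hp : ∀ e ∈ b \ {e₀}, ∃ C, M.IsCircuit C ∧ C ∩ b = {e, e₀} := fun e he ↦
      exists_isCircuit_inter_eq_pair hb he.1 he₀ he.2
    choose! p hp hpb using hp
    have hpe : ∀ e ∈ b \ {e₀}, v (p e) e ≠ 0 := fun e he ↦
      (hvo _ (hp e he) e).2 ((hpb e he).symm.subset (by simp)).1
    have hpe₀ : ∀ e ∈ b \ {e₀}, v (p e) e₀ ≠ 0 := fun e he ↦
      (hvo _ (hp e he) e₀).2 ((hpb e he).symm.subset (by simp)).1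
    -- Normalised at `e₀`, these values are forced by orthogonality to the circuits `p e`.
    refine ⟨fun e ↦ if e = e₀ then 1 else - (v (p e) e₀ / v (p e) e), fun e he ↦ ?_, fun o ho ↦ ?_⟩
    · by_cases hee : e = e₀
      · simp [hee]
      · simp [hee, hpe e ⟨he, hee⟩, hpe₀ e ⟨he, hee⟩]
    have hob : (o ∩ (b \ {e₀})).Finite :=
      (hM o b ho hb).subset (inter_subset_inter_right _ sdiff_subset)
    set T := hob.toFinset with hT
    have hTmem : ∀ {e}, e ∈ T → e ∈ b \ {e₀} := fun he ↦ (hob.mem_toFinset.1 he).2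
    set w : α → k := v o - ∑ e ∈ T, (v o e / v (p e) e) • v (p e) with hw
    have hwdep : w ∈ thinDependences M.E f :=
      Submodule.sub_mem _ (hv o ho) (Submodule.sum_mem _ fun e he ↦
        Submodule.smul_mem _ _ (hv _ (hp e (hTmem he))))
    have hwapp : ∀ x, w x = v o x - ∑ e ∈ T, (v o e / v (p e) e) * v (p e) x := fun x ↦ by
      simp [hw, Finset.sum_apply]
    have hwb : ∀ x ∈ b \ {e₀}, w x = 0 := by
      intro x hx
      have hsum : ∀ e ∈ T, e ≠ x → (v o e / v (p e) e) * v (p e) x = 0 := by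
        intro e he hex
        have hxp : x ∉ p e := by
          intro hxp
          have : x ∈ ({e, e₀} : Set α) := hpb e (hTmem he) ▸ ⟨hxp, hx.1⟩
          obtain h | h := this
          · exact hex h.symm
          · exact hx.2 h
        rw [not_not.1 (mt (hvo _ (hp e (hTmem he)) x).1 hxp), mul_zero]
      rw [hwapp, Finset.sum_eq_single x hsum]
      · rw [div_mul_cancel₀ _ (hpe x hx), sub_self]
      · intro hxT
        have hxo : x ∉ o := fun hxo ↦ hxT (hob.mem_toFinset.2 ⟨hxo, hx⟩)
        rw [not_not.1 (mt (hvo o ho x).1 hxo), zero_div, zero_mul]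
    have hw₀ : w e₀ = 0 := by
      by_contra h
      obtain ⟨o', ho', he₀o', hsupp⟩ :=
        exists_isCircuit_subset_support hf hwdep (hb.subset_ground he₀) h
      refine ho'.inter_isCocircuit_ne_singleton hb (e := e₀) (subset_antisymm ?_ ?_)
      · rintro x ⟨hxo', hxb⟩
        exact by_contra fun hne ↦ hsupp x hxo' (hwb x ⟨hxb, hne⟩)
      · rintro _ rfl
        exact ⟨he₀o', he₀⟩
    -- Adding `e₀` is harmless when `e₀ ∉ o`, since then `v o e₀ = 0`; the resulting sum is exactly
    -- `w e₀`.
    rw [sumsToZero_congr (s' := insert e₀ (o ∩ (b \ {e₀})))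
      (g' := fun e ↦ v o e * if e = e₀ then 1 else - (v (p e) e₀ / v (p e) e)) ?_ (fun _ _ ↦ rfl),
      sumsToZero_iff_of_finset (t := insert e₀ T), Finset.sum_insert]
    · rw [hwapp, sub_eq_add_neg, ← Finset.sum_neg_distrib] at hw₀
      rw [if_pos rfl, mul_one, ← hw₀]
      congr 1
      refine Finset.sum_congr rfl fun e he ↦ ?_
      rw [if_neg (show e ≠ e₀ from (hTmem he).2)]
      ring
    · exact fun h ↦ (hTmem h).2 rfl
    · simp [hT]
    · intro e he heT
      exact (heT (by simpa [hT] using he)).elim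
    · intro e he he'
      have : e ∉ o := by
        intro heo
        obtain rfl | h := he
        · exact he' ⟨heo, he₀⟩
        · exact he' ⟨heo, h.2.1⟩
      rw [not_not.1 (mt (hvo o ho e).1 this), zero_mul]
    · rintro e ⟨heo, heb⟩
      by_cases hee : e = e₀
      · exact Or.inl hee
      · exact Or.inr ⟨heo, heb, hee⟩
  choose! d hd hod using hd
  refine ⟨fun o e ↦ if h : v o e ≠ 0 then Units.mk0 _ h else 1,
    fun b e ↦ if h : d b e ≠ 0 then Units.mk0 _ h else 1, fun o b ho hb ↦ ?_⟩
  refine (sumsToZero_congr subset_rfl ?_ fun e he h ↦ (h he).elim).1 (hod b hb o ho)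
  rintro e ⟨heo, heb⟩
  simp [(hvo o ho e).2 heo, hd b hb e heb]

end Supports

/-! ### Finite matroids and compactness -/

section FiniteMinors

variable {α k : Type*} [Field k] {M : Matroid α}

lemma IsThinSumsMatroid.isRepresentable [M.Finite] (h : IsThinSumsMatroid M k) :
    IsRepresentable M k := by
  obtain ⟨A, f, hf⟩ := h
  exact ⟨A → k, inferInstance, inferInstance, f, fun I hI ↦ by
    rw [hf I hI, isThinlyIndependent_iff_linearIndepOn M.ground_finite hI]⟩

/-- Evaluation embeds a vector space into the functions on its dual. -/
lemma IsRepresentable.isThinSumsMatroid [M.Finite] (h : IsRepresentable M k) :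
    IsThinSumsMatroid M k := by
  obtain ⟨V, _, _, φ, hφ⟩ := h
  set ev : V →ₗ[k] (Module.Dual k V → k) := LinearMap.pi fun a ↦ a with hev
  have hinj : LinearMap.ker ev = ⊥ := by
    rw [LinearMap.ker_eq_bot']
    intro x hx
    exact (Module.forall_dual_apply_eq_zero_iff k x).1 fun a ↦ congr_fun hx a
  refine ⟨Module.Dual k V, fun e ↦ ev (φ e), fun I hI ↦ ?_⟩
  rw [hφ I hI, isThinlyIndependent_iff_linearIndepOn M.ground_finite hI]
  exact (ev.linearIndependent_iff hinj).symm

lemma isTame_of_finite [M.Finite] : IsTame M := fun _ _ ho _ ↦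
  (M.ground_finite.subset ho.subset_ground).subset inter_subset_left

/-- For a finite field, the existence of a painting is a compactness property: it suffices to
paint finitely many circuits and cocircuits at a time. -/
lemma IsTame.isPaintable_of_forall_finite [Finite k] (hM : IsTame M)
    (h : ∀ 𝓞 𝓑 : Set (Set α), 𝓞.Finite → 𝓑.Finite → (∀ o ∈ 𝓞, M.IsCircuit o) →
      (∀ b ∈ 𝓑, M.IsCocircuit b) → ∃ c d : Set α → α → kˣ, ∀ o ∈ 𝓞, ∀ b ∈ 𝓑,
        SumsToZero (o ∩ b) (fun e ↦ (c o e : k) * (d b e : k))) :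
    IsPaintable M k := by
  classical
  let _ : TopologicalSpace k := ⊥
  have : DiscreteTopology k := ⟨rfl⟩
  let _ : TopologicalSpace kˣ := ⊥
  have : DiscreteTopology kˣ := ⟨rfl⟩
  let P := {o // M.IsCircuit o} × {b // M.IsCocircuit b}
  let Z : P → Set ((Set α → α → kˣ) × (Set α → α → kˣ)) := fun p ↦
    {x | SumsToZero (p.1.1 ∩ p.2.1) (fun e ↦ (x.1 p.1.1 e : k) * (x.2 p.2.1 e : k))}
  have hZ : ∀ p, IsClosed (Z p) := by
    rintro ⟨⟨o, ho⟩, ⟨b, hb⟩⟩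
    have hfin := hM o b ho hb
    have hval : Continuous (fun u : kˣ ↦ (u : k)) := continuous_of_discreteTopology
    have hZeq : Z ⟨⟨o, ho⟩, ⟨b, hb⟩⟩ =
        {x | ∑ e ∈ hfin.toFinset, (x.1 o e : k) * (x.2 b e : k) = 0} := by
      ext x
      refine sumsToZero_iff_of_finset (by simp) ?_
      intro e he he'
      exact (he' (by simpa using he)).elim
    rw [hZeq]
    refine isClosed_eq (continuous_finsetSum _ fun e _ ↦ ?_) continuous_const
    exact (hval.comp (by fun_prop)).mul (hval.comp (by fun_prop))
  -- The space of pairs is a product of finite discrete spaces, hence compact.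
  have hne : (⋂ p, Z p).Nonempty := by
    refine CompactSpace.iInter_nonempty hZ fun u ↦ ?_
    obtain ⟨c, d, hcd⟩ := h ((fun p : P ↦ p.1.1) '' u) ((fun p : P ↦ p.2.1) '' u)
      (u.finite_toSet.image _) (u.finite_toSet.image _) (by rintro _ ⟨p, -, rfl⟩; exact p.1.2)
      (by rintro _ ⟨p, -, rfl⟩; exact p.2.2)
    exact ⟨⟨c, d⟩, mem_iInter₂.2 fun p hp ↦
      hcd _ (mem_image_of_mem _ hp) _ (mem_image_of_mem _ hp)⟩
  obtain ⟨⟨c, d⟩, hcd⟩ := hne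
  exact ⟨c, d, fun o b ho hb ↦ mem_iInter.1 hcd ⟨⟨o, ho⟩, ⟨b, hb⟩⟩⟩

lemma IsTame.isPaintable_of_forall_finite_isMinor [Finite k] (hM : IsTame M)
    (h : ∀ N, N ≤m M → N.Finite → IsPaintable N k) : IsPaintable M k := by
  refine hM.isPaintable_of_forall_finite fun 𝓞 𝓑 h𝓞 h𝓑 hO hB ↦ ?_
  obtain ⟨N, hNM, hN, h1, h2⟩ := hM.exists_finite_minor h𝓞 h𝓑 hO hB
  obtain ⟨c, d, hcd⟩ := h N hNM hN
  choose! p hp hpo hbp using h1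
  choose! q hq hqb hoq using h2
  refine ⟨fun o ↦ c (p o), fun b ↦ d (q b), fun o ho b hb ↦ ?_⟩
  have hinter : o ∩ b = p o ∩ q b := subset_antisymm
    (subset_inter (hbp o ho b hb) (hoq b hb o ho)) (inter_subset_inter (hpo o ho) (hqb b hb))
  rw [hinter]
  exact hcd _ _ (hp o ho) (hq b hb)

end FiniteMinors

end ThinSums

theorem theorem4p5 {α : Type*} (M : Matroid α) (hM : ThinSums.IsTame M)
    (k : Type*) [Field k] [Finite k] :
    List.TFAE [
      ThinSums.IsThinSumsMatroid M k,
      ThinSums.IsPaintable M k,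
      ∀ N : Matroid α, N.IsMinor M → N.Finite → ThinSums.IsRepresentable N k] := by
  tfae_have 1 → 2 := fun h ↦ h.isPaintable hM
  tfae_have 2 → 1 := fun h ↦ h.isThinSumsMatroid
  tfae_have 2 → 3 := fun h N hNM hN ↦ (h.of_isMinor hNM).isThinSumsMatroid.isRepresentable
  tfae_have 3 → 2 := fun h ↦ hM.isPaintable_of_forall_finite_isMinor fun N hNM hN ↦
    (h N hNM hN).isThinSumsMatroid.isPaintable ThinSums.isTame_of_finite
  tfae_finish
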